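/- Let $n\ge 2$. An open set $\Omega\subseteq\mathbb R^n$ is of class $C^m$ if for every $p\in\partial\Omega$ there are $R\in O_n(\mathbb R)$, $r,\delta>0$ and $\gamma\in C^m(\mathbb B_{n-1}(0,r))$ with $\gamma(0)=0$, $|\gamma|<\delta/2$ such that $R(\Omega-p)\cap(\mathbb B_{n-1}(0,r)\times]-\delta,\delta[)=\{(\eta,y)\in\mathbb B_{n-1}(0,r)\times]-\delta,\delta[\,:\ y<\gamma(\eta)\}$. Let $\Omega$ be a bounded open subset of $\mathbb R^n$ of class $C^1$ with outer unit normal $\nu_\Omega$, let $U$ be an open set of class $C^\infty$ containing $\partial\Omega$, and let $a\in C^\infty(\overline U,\mathbb R^n)$ (all derivatives extend continuously to $\overline U$) satisfy, for some $\vartheta\in]0,1[$ and $\tau>0$, $$|a|=1\ \text{on }\overline U,\qquad \sup_{\partial\Omega}|a-\nu_\Omega|<\vartheta,\qquad \inf_{\partial\Omega}a\cdot\nu_\Omega>1-\tfrac{\vartheta^2}{2},$$ $$|a(x)\cdot(y-x)|\le\vartheta|x-y|\quad\text{for all }x,y\in\partial\Omega\text{ with }|x-y|<\tau .$$ Let $t_1>0$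 be such that (i) the map $(x,t)\mapsto x+ta(x)$ is injective on $\partial\Omega\times]-t_1,t_1[$, and for every $t_2\in]0,t_1]$ the image of $\partial\Omega\times]-t_2,t_2[$ is an open neighborhood of $\partial\Omega$; (ii) for all $x\in\partial\Omega$, $x+ta(x)\in\Omega$ if $t\in]-t_1,0[$, and $x+ta(x)\in\mathbb R^n\setminus\overline\Omega$ if $t\in]0,t_1[$. Let $\omega_1(0)=0$, $\omega_1(r)=r|\ln r|$ for $0<r\le e^{-1}$, $\omega_1(r)=e^{-1}$ for $r>e^{-1}$, and set $$|f:\Omega|_{\omega_1}=\sup_{x,y\in\Omega,\,x\ne y}\frac{|f(x)-f(y)|}{\omega_1(|x-y|)},\qquad M(f)=\sup\{|\ln|t||^{-1}\,|\nabla f(x+ta(x))|:\ x\in\partial\Omega,\ t\in]-t_1,0[\},$$ where $|\nabla f|$ is the Euclidean norm of the vector of the partial derivatives; if $t_1>1$, the expression at $t=-1$ is read as $0$ where $\nabla f$ vanishes and as $+\infty$ elsewhere. A supremum over the empty set is $0$. Then there are $B\in]0,+\infty[$ and a compact set $H\subset\Omega$ such that $$\sup_\Omega|f|+|f:\Omega|_{\omega_1}\le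 B\,\max\Big\{\sup_H|f|,\ \sup_H|\nabla f|,\ M(f)\Big\}$$ for every (real or complex valued) continuously differentiable function $f$ on $\Omega$ with $M(f)<+\infty$. -/

import Mathlib

open Set
open scoped ENNReal

namespace OmegaHolder

/-- `ℝⁿ` with its Euclidean norm. -/
abbrev E (n : ℕ) : Type := EuclideanSpace ℝ (Fin n)

/-- `ℝⁿ⁻¹ × ℝ` with its Euclidean norm; a linear isometry `R : E n ≃ₗᵢ[ℝ] Cyl n` is an orthogonal
transformation of `ℝⁿ` followed by the splitting `x = (η, y)` with `η ∈ ℝⁿ⁻¹`, `y ∈ ℝ`. -/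
abbrev Cyl (n : ℕ) : Type := WithLp 2 (E (n - 1) × ℝ)

/-! ### Open sets of class `C^m` -/

/-- `p + Rᵗ(𝔹_{n-1}(0,r) × ]-δ,δ[)` is a coordinate cylinder for `Ω` around `p`, in which `∂Ω` is
represented as the graph of `γ`: inside the cylinder `Ω` is the strict hypograph of `γ`. -/
structure IsCoordCylinder {n : ℕ} (Ω : Set (E n)) (p : E n) (R : E n ≃ₗᵢ[ℝ] Cyl n) (r δ : ℝ)
    (γ : E (n - 1) → ℝ) : Prop where
  r_pos : 0 < r
  delta_pos : 0 < δ
  continuousOn : ContinuousOn γ (Metric.ball 0 r)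
  map_zero : γ 0 = 0
  abs_lt : ∀ η ∈ Metric.ball (0 : E (n - 1)) r, |γ η| < δ / 2
  mem_iff : ∀ η ∈ Metric.ball (0 : E (n - 1)) r, ∀ y ∈ Ioo (-δ) δ,
    (p + R.symm (WithLp.toLp 2 (η, y)) ∈ Ω ↔ y < γ η)

/-- `Ω` is an open subset of `ℝⁿ` of class `C^m` (smooth is `m = (⊤ : ℕ∞)`). -/
def IsOpenOfClass {n : ℕ} (m : WithTop ℕ∞) (Ω : Set (E n)) : Prop :=
  IsOpen Ω ∧ ∀ p ∈ frontier Ω, ∃ (R : E n ≃ₗᵢ[ℝ] Cyl n) (r δ : ℝ) (γ : E (n - 1) → ℝ),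
    IsCoordCylinder Ω p R r δ γ ∧ ContDiffOn ℝ m γ (Metric.ball 0 r)

/-! ### The outer unit normal -/

/-- `v = Rᵗ(-∇γ(0), 1) / √(1 + |∇γ(0)|²)` for a `C¹` representation `γ` of `∂Ω` around `p`. -/
def IsOuterUnitNormal {n : ℕ} (Ω : Set (E n)) (p v : E n) : Prop :=
  ∃ (R : E n ≃ₗᵢ[ℝ] Cyl n) (r δ : ℝ) (γ : E (n - 1) → ℝ),
    IsCoordCylinder Ω p R r δ γ ∧ ContDiffOn ℝ 1 γ (Metric.ball 0 r) ∧
    v = (√(1 + ‖gradient γ 0‖ ^ 2))⁻¹ • R.symm (WithLp.toLp 2 (-gradient γ 0, (1 : ℝ)))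

/-- The outer unit normal `ν_Ω` at the points of `∂Ω`, for `Ω` of class `C¹`. -/
noncomputable def outerUnitNormal {n : ℕ} (Ω : Set (E n)) (p : E n) : E n :=
  Classical.epsilon (IsOuterUnitNormal Ω p)

theorem isOuterUnitNormal_outerUnitNormal {n : ℕ} {Ω : Set (E n)} (hΩ : IsOpenOfClass 1 Ω)
    {p : E n} (hp : p ∈ frontier Ω) : IsOuterUnitNormal Ω p (outerUnitNormal Ω p) := by
  obtain ⟨R, r, δ, γ, h, hγ⟩ := hΩ.2 p hp
  exact Classical.epsilon_spec (p := IsOuterUnitNormal Ω p) ⟨_, R, r, δ, γ, h, hγ, rfl⟩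

open Filter Topology in
/-- An outer unit normal is a unit vector, and it separates the directions that enter `Ω` from
those that leave it. -/
theorem IsOuterUnitNormal.separates {n : ℕ} {Ω : Set (E n)} {p v : E n} (h : IsOuterUnitNormal Ω p v) (w : E n) :
    ‖v‖ = 1 ∧
    (inner ℝ v w < 0 → ∀ᶠ s in 𝓝[>] (0:ℝ), p + s • w ∈ Ω) ∧
    (0 < inner ℝ v w → ∀ᶠ s in 𝓝[>] (0:ℝ), p + s • w ∉ Ω) := by
  obtain ⟨R, r, δ, γ, hc, hγ, rfl⟩ := h
  set g := gradient γ 0 with hg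
  have hpos : 0 < √(1 + ‖g‖ ^ 2) := by positivity
  obtain ⟨η, y, hw⟩ : ∃ (η : E (n-1)) (y : ℝ), w = R.symm (WithLp.toLp 2 (η, y)) :=
    ⟨(R w).fst, (R w).snd, (R.symm_apply_apply w).symm⟩
  have hin : inner ℝ ((√(1 + ‖g‖ ^ 2))⁻¹ • R.symm (WithLp.toLp 2 (-g, (1 : ℝ)))) w
      = (√(1 + ‖g‖ ^ 2))⁻¹ * (y - inner ℝ g η) := by
    rw [hw, inner_smul_left, LinearIsometryEquiv.inner_map_map, WithLp.prod_inner_apply]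
    simp; left; ring
  have hd : HasDerivAt (fun s : ℝ => γ (s • η)) (inner ℝ g η) 0 := by
    have h1 : DifferentiableAt ℝ γ 0 :=
      (hγ.differentiableOn (by norm_num)).differentiableAt (Metric.ball_mem_nhds _ hc.r_pos)
    have h2 := h1.hasGradientAt.hasFDerivAt
    have h3 : HasDerivAt (fun s : ℝ => s • η) η 0 := by
      simpa using (hasDerivAt_id (0:ℝ)).smul_const η
    have h4 := HasFDerivAt.comp_hasDerivAt_of_eq (0:ℝ) h2 h3 (by simp)
    simpa only [Function.comp_def, InnerProductSpace.toDual_apply_apply] using h4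
  have hsl : Tendsto (fun s : ℝ => s⁻¹ * γ (s • η)) (𝓝[>] 0) (𝓝 (inner ℝ g η)) := by
    have := hd.tendsto_slope_zero_right
    simpa [hc.map_zero] using this
  have hb : ∀ᶠ s in 𝓝[>] (0:ℝ), s • η ∈ Metric.ball (0 : E (n-1)) r := by
    apply eventually_nhdsWithin_of_eventually_nhds
    have : ContinuousAt (fun s : ℝ => s • η) 0 := by fun_prop
    exact this.eventually_mem (Metric.isOpen_ball.mem_nhds (by simpa using hc.r_pos))
  have hy : ∀ᶠ s in 𝓝[>] (0:ℝ), s * y ∈ Ioo (-δ) δ := by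
    apply eventually_nhdsWithin_of_eventually_nhds
    have : ContinuousAt (fun s : ℝ => s * y) 0 := by fun_prop
    exact this.eventually_mem (isOpen_Ioo.mem_nhds (by simpa using hc.delta_pos))
  have key : ∀ᶠ s in 𝓝[>] (0:ℝ), (p + s • w ∈ Ω ↔ y < s⁻¹ * γ (s • η)) := by
    filter_upwards [hb, hy, self_mem_nhdsWithin] with s h1 h2 (h3 : 0 < s)
    have h4 := hc.mem_iff _ h1 _ h2
    have h5 : R.symm (WithLp.toLp 2 (s • η, s * y)) = s • w := by
      rw [hw, ← map_smul]; rfl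
    rw [h5] at h4
    rw [h4, inv_mul_eq_div, lt_div_iff₀ h3, mul_comm]
  refine ⟨?_, ?_, ?_⟩
  · rw [norm_smul, LinearIsometryEquiv.norm_map, WithLp.prod_norm_eq_of_L2]
    have : ‖g‖ ^ 2 + 1 = 1 + ‖g‖^2 := by ring
    simp [this, abs_of_pos hpos]
    exact inv_mul_cancel₀ hpos.ne'
  · rw [hin]
    intro h
    have h' : y < inner ℝ g η := by
      have := neg_of_mul_neg_right h (inv_pos.2 hpos).le
      linarith
    filter_upwards [key, hsl.eventually_const_lt h'] with s h1 h2
    exact h1.2 h2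
  · rw [hin]
    intro h
    have h' : inner ℝ g η < y := by
      have := (pos_iff_pos_of_mul_pos h).1 (inv_pos.2 hpos)
      linarith
    filter_upwards [key, hsl.eventually_lt_const h'] with s h1 h2
    rw [h1]; exact not_lt.2 h2.le

/-- The outer unit normal does not depend on the coordinate cylinder. -/
theorem IsOuterUnitNormal.unique {n : ℕ} {Ω : Set (E n)} {p v v' : E n}
    (h : IsOuterUnitNormal Ω p v) (h' : IsOuterUnitNormal Ω p v') : v = v' := by
  have h1 := (h.separates 0).1
  have h2 := (h'.separates 0).1
  by_contra hne
  have hlt : inner ℝ v v' < 1 := (inner_lt_one_iff_real_of_norm_eq_one h1 h2).2 hne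
  have e1 : inner ℝ v (v' - v) < 0 := by
    rw [inner_sub_right, real_inner_self_eq_norm_sq, h1]; linarith
  have e2 : 0 < inner ℝ v' (v' - v) := by
    rw [inner_sub_right, real_inner_self_eq_norm_sq, h2, real_inner_comm]; linarith
  obtain ⟨s, ha, hb⟩ := (((h.separates _).2.1 e1).and ((h'.separates _).2.2 e2)).exists
  exact hb ha

/-! ### Regularity up to the boundary -/

/-- `f ∈ C^m(closure U)`: `f` is continuous on the closure of `U`, it is of class `C^m` in `U`, and
all its derivatives of (finite) order at most `m` extend continuously to the closure of `U`. -/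
def ContDiffClosure {n k : ℕ} (m : ℕ∞) (f : E n → E k) (U : Set (E n)) : Prop :=
  ContinuousOn f (closure U) ∧ ContDiffOn ℝ m f U ∧
    ∀ j : ℕ, (j : ℕ∞) ≤ m → ∃ g : E n → (E n [×j]→L[ℝ] E k),
      ContinuousOn g (closure U) ∧ EqOn (iteratedFDeriv ℝ j f) g U

/-! ### The transversal field and the tubular neighbourhood -/

/-- `a` is a unit vector field on the closure of `U` which is `ϑ`-close to the outer unit normal of
`Ω` on `∂Ω` and almost orthogonal to the short chords of `∂Ω`. The supremum and the infimum are
taken in the extended reals. -/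
structure IsTransversalField {n : ℕ} (Ω U : Set (E n)) (a : E n → E n) (ϑ τ : ℝ) : Prop where
  norm_eq : ∀ x ∈ closure U, ‖a x‖ = 1
  sup_lt : (⨆ x ∈ frontier Ω, ‖a x - outerUnitNormal Ω x‖ₑ) < ENNReal.ofReal ϑ
  lt_inf : ((1 - ϑ ^ 2 / 2 : ℝ) : EReal) <
    ⨅ x ∈ frontier Ω, ((inner ℝ (a x) (outerUnitNormal Ω x) : ℝ) : EReal)
  abs_inner_le : ∀ x ∈ frontier Ω, ∀ y ∈ frontier Ω, ‖x - y‖ < τ →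
    |inner ℝ (a x) (y - x)| ≤ ϑ * ‖x - y‖

/-- `A(t) = {x + s a(x) : x ∈ ∂Ω, s ∈ ]-t,t[}`. -/
def tube {n : ℕ} (Ω : Set (E n)) (a : E n → E n) (t : ℝ) : Set (E n) :=
  (fun q : E n × ℝ => q.1 + q.2 • a q.1) '' (frontier Ω ×ˢ Ioo (-t) t)

/-- `(x, t) ↦ x + t a(x)` parametrizes a tubular neighbourhood of `∂Ω` for `|t| < t₁`, with
`t < 0` corresponding to the inside of `Ω` and `t > 0` to the outside. -/
structure IsTubeRadius {n : ℕ} (Ω : Set (E n)) (a : E n → E n) (t₁ : ℝ) : Prop where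
  pos : 0 < t₁
  injOn : InjOn (fun q : E n × ℝ => q.1 + q.2 • a q.1) (frontier Ω ×ˢ Ioo (-t₁) t₁)
  isOpen_tube : ∀ t₂ ∈ Ioc 0 t₁, IsOpen (tube Ω a t₂) ∧ frontier Ω ⊆ tube Ω a t₂
  inside : ∀ x ∈ frontier Ω, ∀ t ∈ Ioo (-t₁) 0, x + t • a x ∈ Ω
  outside : ∀ x ∈ frontier Ω, ∀ t ∈ Ioo 0 t₁, x + t • a x ∈ (closure Ω)ᶜ

/-! ### The quantities in the estimate, with values in `[0, ∞]` -/

/-- `ω₁(r) = r |ln r|` for `0 < r ≤ 1/e`, with `ω₁(0) = 0` and `ω₁` constant on `[1/e, ∞[`. -/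
noncomputable def omegaOne (r : ℝ) : ℝ :=
  if r ≤ 0 then 0
  else if r ≤ Real.exp (-1) then r * |Real.log r|
  else Real.exp (-1) * |Real.log (Real.exp (-1))|

/-- `sup_D |f|`. -/
noncomputable def supOn {α F : Type*} [ENorm F] (D : Set α) (f : α → F) : ℝ≥0∞ :=
  ⨆ x ∈ D, ‖f x‖ₑ

/-- The `w`-Hölder constant `|f : D|_w`. -/
noncomputable def holderConst {n : ℕ} {F : Type*} [NormedAddCommGroup F] (w : ℝ → ℝ)
    (f : E n → F) (D : Set (E n)) : ℝ≥0∞ :=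
  ⨆ x ∈ D, ⨆ y ∈ D, ⨆ _ : x ≠ y, ‖f x - f y‖ₑ / ENNReal.ofReal (w ‖x - y‖)

/-- `∇f(x) = (∂₁f(x), …, ∂ₙf(x))`, for real or complex valued `f`, with the Euclidean norm. -/
noncomputable def grad {n : ℕ} {𝕜 : Type*} [RCLike 𝕜] (f : E n → 𝕜) (x : E n) :
    EuclideanSpace 𝕜 (Fin n) :=
  WithLp.toLp 2 fun j => fderiv ℝ f x (EuclideanSpace.single j 1)

/-- `sup { |ln |t||⁻¹ |∇f(x + t a(x))| : x ∈ ∂Ω, t ∈ ]-t₁,0[ }`. -/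
noncomputable def logGradSup {n : ℕ} {𝕜 : Type*} [RCLike 𝕜] (Ω : Set (E n)) (a : E n → E n)
    (t₁ : ℝ) (f : E n → 𝕜) : ℝ≥0∞ :=
  ⨆ x ∈ frontier Ω, ⨆ t ∈ Ioo (-t₁) 0, ‖Real.log |t|‖ₑ⁻¹ * ‖grad f (x + t • a x)‖ₑ

end OmegaHolder

open OmegaHolder

namespace OmegaHolder

/-! If the ball of radius `r` about `p = x + t a(x)` lies in `Ω`, then `r ≤ |t|`, because `x ∉ Ω`
and `|a(x)| = 1`. Finiteness of `M(f)`, with a bound on a compact set away from `∂Ω`, thus gives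
`|∇f(p)| ≤ K (1 - ln r)` whenever `ball p r ⊆ Ω` and `r ≤ 1` (`norm_grad_le_neg_log`). From there
only the shape of `Ω` matters.

Nearby points are vertices of interior cones with a common axis and uniform size
(`exists_uniform_cone`). The logarithm is integrable, so climbing a height `S` along the axis costs
`O(S (1 + |ln S|))` (`norm_sub_le_along_cone`). For `r = |x - y|` small, climb from `x` and `y` to a
height comparable to `r` and cross there: the total is `O(r |ln r|)` (`norm_sub_le_mul_log`).
Climbing to a fixed height ends in a compact set, which bounds `sup |f|` and hence settles distant
pairs. -/

open Metric Filter Topology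

/-! ### Interior cones of `C¹` sets -/

/-- Near a boundary point, the points of a set of class `C¹` are vertices of cones contained in the
set, with a common axis and a common opening. -/
theorem IsOpenOfClass.exists_local_cone {n : ℕ} {Ω : Set (E n)} (hΩ : IsOpenOfClass 1 Ω)
    {p : E n} (hp : p ∈ frontier Ω) :
    ∃ c ∈ Ioc (0 : ℝ) 1, ∃ ρ > 0, ∃ e : E n, ‖e‖ ≤ 1 ∧ ∀ y ∈ Ω, dist y p < ρ → ∀ s ∈ Ioc 0 ρ,
      ball (y + s • e) (c * s) ⊆ Ω := by
  obtain ⟨R, r, δ, γ, h, hγ⟩ := hΩ.2 p hp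
  have hγ0 : ContDiffAt ℝ 1 γ 0 := hγ.contDiffAt (ball_mem_nhds _ h.r_pos)
  obtain ⟨L, t, ht, hL⟩ := hγ0.exists_lipschitzOnWith
  obtain ⟨r', hr', hr't⟩ := Metric.mem_nhds_iff.1 (inter_mem ht (ball_mem_nhds _ h.r_pos))
  -- With `c (1 + L) = 1`, a drop by `s` outweighs the error `c s` in height plus the change `L c s`
  -- of `γ`.
  have hc : 0 < (1 + (L : ℝ))⁻¹ := by positivity
  have hcL : (1 + (L : ℝ))⁻¹ * (1 + L) = 1 := inv_mul_cancel₀ (by positivity)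
  have hc1 : (1 + (L : ℝ))⁻¹ ≤ 1 := inv_le_one_of_one_le₀ (by simp)
  set c : ℝ := (1 + (L : ℝ))⁻¹
  have hm : 0 < min r' δ := lt_min hr' h.delta_pos
  have hm1 := min_le_left r' δ
  have hm2 := min_le_right r' δ
  -- A third suffices: `|v| < ρ`, and the displacement `s + c s` is at most `2ρ`.
  set ρ : ℝ := min r' δ / 3 with hρ
  have hfst (v : Cyl n) : ‖v.fst‖ ≤ ‖v‖ := WithLp.norm_fst_le _ v
  have hsnd (v : Cyl n) : |v.snd| ≤ ‖v‖ := WithLp.norm_snd_le _ v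
  refine ⟨c, ⟨hc, hc1⟩, ρ, by positivity, R.symm (WithLp.toLp 2 (0, -1)), ?_, ?_⟩
  · rw [LinearIsometryEquiv.norm_map, WithLp.prod_norm_eq_of_L2]
    simp
  · intro y hy hyp s hs z hz
    obtain ⟨hs0, hsρ⟩ := hs
    obtain ⟨v, rfl⟩ : ∃ v, y = p + R.symm v := ⟨R (y - p), by simp⟩
    obtain ⟨w, rfl⟩ : ∃ w, z = p + R.symm w := ⟨R (z - p), by simp⟩
    have hv : ‖v‖ < ρ := by simpa [dist_eq_norm] using hyp
    have hzw : ‖w - v - s • WithLp.toLp 2 (0, -1)‖ < c * s := by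
      rw [mem_ball, dist_eq_norm] at hz
      rw [← R.symm.norm_map]
      convert hz using 2
      simp only [map_sub, map_smul]
      abel
    have hcs : c * s ≤ s := mul_le_of_le_one_left hs0.le hc1
    have h1 : ‖w.fst - v.fst‖ < c * s := by
      have := hfst (w - v - s • WithLp.toLp 2 (0, -1))
      simp at this
      linarith
    have h2 : |w.snd - v.snd + s| < c * s := by
      have := hsnd (w - v - s • WithLp.toLp 2 (0, -1))
      simp at this
      linarith
    have hv1 := (hfst v).trans_lt hv
    have hv2 := (hsnd v).trans_lt hv
    have hw1 : ‖w.fst‖ < r' := by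
      have := norm_add_le (w.fst - v.fst) v.fst
      rw [sub_add_cancel] at this
      linarith
    rw [abs_lt] at h2 hv2
    have hvb : v.fst ∈ ball (0 : E (n - 1)) r' := by
      rw [mem_ball_zero_iff]; linarith
    have hwb : w.fst ∈ ball (0 : E (n - 1)) r' := by rwa [mem_ball_zero_iff]
    have hvΩ := (h.mem_iff v.fst (hr't hvb).2 v.snd ⟨by linarith, by linarith⟩).1 hy
    refine (h.mem_iff w.fst (hr't hwb).2 w.snd ⟨by linarith, by linarith⟩).2 ?_
    have h3 := hL.dist_le_mul _ (hr't hwb).1 _ (hr't hvb).1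
    rw [Real.dist_eq, dist_eq_norm] at h3
    have h4 : (L : ℝ) * ‖w.fst - v.fst‖ ≤ L * (c * s) := by gcongr
    have h5 := abs_le.1 (h3.trans h4)
    have h6 : c * s + L * (c * s) = s := by linear_combination s * hcL
    linarith

/-- A bounded open set of class `C¹` satisfies a uniform interior cone condition. -/
theorem IsOpenOfClass.exists_uniform_cone {n : ℕ} {Ω : Set (E n)} (hΩ : IsOpenOfClass 1 Ω)
    (hb : Bornology.IsBounded Ω) :
    ∃ c ∈ Ioc (0 : ℝ) 1, ∃ ρ > 0, ∀ x ∈ Ω, ∃ e : E n, ‖e‖ ≤ 1 ∧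
      ∀ y ∈ Ω, dist y x < ρ → ∀ s ∈ Ioc 0 ρ, ball (y + s • e) (c * s) ⊆ Ω := by
  suffices H : ∃ c ∈ Ioc (0 : ℝ) 1, ∃ ρ > 0, ∀ x ∈ closure Ω, ∃ e : E n, ‖e‖ ≤ 1 ∧
      ∀ y ∈ Ω, dist y x < ρ → ∀ s ∈ Ioc 0 ρ, ball (y + s • e) (c * s) ⊆ Ω by
    obtain ⟨c, hc, ρ, hρ, H⟩ := H
    exact ⟨c, hc, ρ, hρ, fun x hx => H x (subset_closure hx)⟩
  -- Having uniform constants on `S` passes to subsets and finite unions, so compactness of the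
  -- closure reduces it to a neighbourhood of each point.
  refine hb.isCompact_closure.induction_on (p := fun S => ∃ c ∈ Ioc (0 : ℝ) 1, ∃ ρ > 0,
    ∀ x ∈ S, ∃ e : E n, ‖e‖ ≤ 1 ∧ ∀ y ∈ Ω, dist y x < ρ → ∀ s ∈ Ioc 0 ρ,
      ball (y + s • e) (c * s) ⊆ Ω) ?_ ?_ ?_ ?_
  · exact ⟨1, by simp, 1, one_pos, by simp⟩
  · rintro S T hST ⟨c, hc, ρ, hρ, H⟩
    exact ⟨c, hc, ρ, hρ, fun x hx => H x (hST hx)⟩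
  · rintro S T ⟨c, hc, ρ, hρ, H⟩ ⟨c', hc', ρ', hρ', H'⟩
    refine ⟨min c c', ⟨lt_min hc.1 hc'.1, (min_le_left _ _).trans hc.2⟩, min ρ ρ',
      lt_min hρ hρ', ?_⟩
    rintro x (hx | hx)
    · obtain ⟨e, he, H⟩ := H x hx
      refine ⟨e, he, fun y hy hyx s hs => (ball_subset_ball ?_).trans
        (H y hy (hyx.trans_le (min_le_left _ _)) s ⟨hs.1, hs.2.trans (min_le_left _ _)⟩)⟩
      exact mul_le_mul_of_nonneg_right (min_le_left _ _) hs.1.le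
    · obtain ⟨e, he, H⟩ := H' x hx
      refine ⟨e, he, fun y hy hyx s hs => (ball_subset_ball ?_).trans
        (H y hy (hyx.trans_le (min_le_right _ _)) s ⟨hs.1, hs.2.trans (min_le_right _ _)⟩)⟩
      exact mul_le_mul_of_nonneg_right (min_le_right _ _) hs.1.le
  · intro p hp
    obtain ⟨c, hc, ρ, hρ, e, he, H⟩ : ∃ c ∈ Ioc (0 : ℝ) 1, ∃ ρ > 0, ∃ e : E n, ‖e‖ ≤ 1 ∧
        ∀ y ∈ Ω, dist y p < ρ → ∀ s ∈ Ioc 0 ρ, ball (y + s • e) (c * s) ⊆ Ω := by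
      by_cases hpΩ : p ∈ Ω
      · obtain ⟨ε, hε, hεΩ⟩ := Metric.isOpen_iff.1 hΩ.1 p hpΩ
        refine ⟨1, by simp, ε / 2, by positivity, 0, by simp, fun y _ hy s hs => ?_⟩
        rw [smul_zero, add_zero, one_mul]
        exact (ball_subset_ball' (by linarith [hs.2])).trans hεΩ
      · exact hΩ.exists_local_cone (hΩ.1.frontier_eq ▸ ⟨hp, hpΩ⟩)
    refine ⟨ball p (ρ / 2), mem_nhdsWithin_of_mem_nhds (ball_mem_nhds _ (by positivity)),
      c, hc, ρ / 2, by positivity, fun x hx => ⟨e, he, fun y hy hyx s hs => H y hy ?_ s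
        ⟨hs.1, by linarith [hs.2]⟩⟩⟩
    linarith [dist_triangle y x p, mem_ball.1 hx]

/-! ### Integrating a logarithmic gradient bound -/

section LogarithmicGradient

variable {V F : Type*} [NormedAddCommGroup V] [NormedSpace ℝ V] [NormedAddCommGroup F]
  [NormedSpace ℝ F] {Ω : Set V} {f : V → F} {K : ℝ}

/-- A logarithmic bound of the derivative is integrable along the axis of an interior cone. -/
theorem norm_sub_le_along_cone (hf : ∀ p ∈ Ω, DifferentiableAt ℝ f p)
    (hbound : ∀ p, ∀ r ∈ Ioc (0 : ℝ) 1, ball p r ⊆ Ω → ‖fderiv ℝ f p‖ ≤ K * (1 - Real.log r))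
    {x e : V} (hx : x ∈ Ω) (he : ‖e‖ ≤ 1) {c S : ℝ} (hc : c ∈ Ioc (0 : ℝ) 1)
    (hS : S ∈ Ioc (0 : ℝ) 1) (hcone : ∀ s ∈ Ioc 0 S, ball (x + s • e) (c * s) ⊆ Ω) :
    ‖f x - f (x + S • e)‖ ≤ K * (S * (2 - Real.log (c * S))) := by
  -- A primitive of `K (1 - log (c s))`, continuous at `0`; the factor `c⁻¹ * c` exposes `u log u`
  -- at `u = c s`.
  set b : ℝ → ℝ := fun s => K * (s * 2 - c⁻¹ * (c * s * Real.log (c * s))) with hb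
  have hmem : ∀ s ∈ Icc 0 S, x + s • e ∈ Ω := by
    intro s hs
    rcases hs.1.eq_or_lt with h | h
    · simpa [← h] using hx
    · exact hcone s ⟨h, hs.2⟩ (mem_ball_self (mul_pos hc.1 h))
  have hbc : Continuous b := by
    have := Real.continuous_mul_log.comp (continuous_const.mul continuous_id : Continuous (c * ·))
    exact continuous_const.mul ((continuous_id.mul continuous_const).sub
      (continuous_const.mul this))
  have hbd : ∀ s, 0 < s → HasDerivAt b (K * (1 - Real.log (c * s))) s := by
    intro s hs
    have h1 : HasDerivAt (fun s : ℝ => c * s) c s := by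
      simpa using (hasDerivAt_id s).const_mul c
    have h2 := (Real.hasDerivAt_mul_log (mul_pos hc.1 hs).ne').comp s h1
    have h3 := (((hasDerivAt_id s).mul_const 2).sub (h2.const_mul c⁻¹)).const_mul K
    refine h3.congr_deriv ?_
    have := hc.1.ne'
    field_simp
    ring
  -- The axis is traversed from the top: the bound is singular at the vertex, and the mean value
  -- inequality needs no derivative at the right endpoint `u = S`.
  have key := image_norm_le_of_norm_deriv_right_le_deriv_boundary' (a := 0) (b := S)
    (f := fun u => f (x + (S - u) • e) - f (x + S • e))
    (f' := fun u => fderiv ℝ f (x + (S - u) • e) (-e))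
    (B := fun u => b S - b (S - u)) (B' := fun u => K * (1 - Real.log (c * (S - u))))
    ?_ ?_ ?_ ?_ ?_ ?_ (x := S) ⟨hS.1.le, le_rfl⟩
  · have h1 : b S - b 0 = K * (S * (2 - Real.log (c * S))) := by
      have := hc.1.ne'
      simp only [hb, mul_zero, zero_mul, sub_zero]
      field_simp
    simpa [h1] using key
  · intro u hu
    refine ContinuousAt.continuousWithinAt (ContinuousAt.sub ?_ continuousAt_const)
    have h1 := (hf _ (hmem (S - u) ⟨by linarith [hu.2], by linarith [hu.1]⟩)).continuousAt
    exact ContinuousAt.comp (f := fun u : ℝ => x + (S - u) • e) h1 (by fun_prop)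
  · intro u hu
    have h1 := (hf _ (hmem (S - u) ⟨by linarith [hu.2], by linarith [hu.1]⟩)).hasFDerivAt
    have h2 : HasDerivAt (fun u : ℝ => x + (S - u) • e) (-e) u := by
      simpa using (((hasDerivAt_id u).const_sub S).smul_const e).const_add x
    exact ((h1.comp_hasDerivAt u h2).sub_const _).hasDerivWithinAt
  · simp
  · exact (continuous_const.sub (hbc.comp (by fun_prop))).continuousOn
  · intro u hu
    have h1 := hbd (S - u) (by linarith [hu.2])
    have h2 := h1.comp u ((hasDerivAt_id u).const_sub S)
    have h3 := h2.const_sub (b S)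
    exact (h3.congr_deriv (by simp)).hasDerivWithinAt
  · intro u hu
    have hs : 0 < S - u := by linarith [hu.2]
    have hcs := mul_pos hc.1 hs
    have h1 : c * (S - u) ≤ 1 := mul_le_one₀ hc.2 hs.le (by linarith [hS.2, hu.1])
    have h2 := hbound (x + (S - u) • e) (c * (S - u)) ⟨hcs, h1⟩
      (hcone _ ⟨hs, by linarith [hu.1]⟩)
    calc ‖fderiv ℝ f (x + (S - u) • e) (-e)‖ ≤ ‖fderiv ℝ f (x + (S - u) • e)‖ * ‖-e‖ :=
          ContinuousLinearMap.le_opNorm _ _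
      _ ≤ ‖fderiv ℝ f (x + (S - u) • e)‖ * 1 := by rw [norm_neg]; gcongr
      _ ≤ _ := by rwa [mul_one]

/-- A logarithmic bound of the derivative gives the modulus of continuity `r |log r|` between two
vertices of interior cones with the same axis. -/
theorem norm_sub_le_mul_log (hf : ∀ p ∈ Ω, DifferentiableAt ℝ f p) (hK : 0 ≤ K)
    (hbound : ∀ p, ∀ r ∈ Ioc (0 : ℝ) 1, ball p r ⊆ Ω → ‖fderiv ℝ f p‖ ≤ K * (1 - Real.log r))
    {x y e : V} (hx : x ∈ Ω) (hy : y ∈ Ω) (he : ‖e‖ ≤ 1) {c ρ : ℝ} (hc : c ∈ Ioc (0 : ℝ) 1)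
    (hρ : ρ ≤ 1) (hxc : ∀ s ∈ Ioc 0 ρ, ball (x + s • e) (c * s) ⊆ Ω)
    (hyc : ∀ s ∈ Ioc 0 ρ, ball (y + s • e) (c * s) ⊆ Ω) (hxy : x ≠ y)
    (hr : ‖x - y‖ ≤ Real.exp (-1)) (hrρ : ‖x - y‖ ≤ c * ρ / 2) :
    ‖f x - f y‖ ≤ K * (12 / c + 2) * (‖x - y‖ * -Real.log ‖x - y‖) := by
  have hr0 : 0 < ‖x - y‖ := norm_pos_iff.2 (sub_ne_zero.2 hxy)
  set r := ‖x - y‖ with hrdef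
  have hlog : Real.log r ≤ -1 := by
    simpa using Real.log_le_log hr0 hr
  have hr1 : r ≤ 1 := hr.trans (Real.exp_le_one_iff.2 (by norm_num))
  have hc0 := hc.1
  -- At this height the cone ball has radius `2r`, so every point of the closed `r`-ball about `x +
  -- S • e`, including `y + S • e`, is the centre of an `r`-ball in `Ω`.
  set S := 2 * r / c with hSdef
  have hcS : c * S = 2 * r := by rw [hSdef]; field_simp
  have hS0 : 0 < S := by positivity
  have hSρ : S ≤ ρ := by
    rw [hSdef, div_le_iff₀ hc0]; linarith
  -- As `-log r ≥ 1`, the factor `2 - log (2r)` is at most `3 (-log r)`; two climbs make up `12 /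
  -- c`.
  have hlegb : K * (S * (2 - Real.log (c * S))) ≤ K * (6 / c * (r * -Real.log r)) := by
    have h1 : Real.log r ≤ Real.log (2 * r) := Real.log_le_log hr0 (by linarith)
    have h2 : S * (2 - Real.log (c * S)) ≤ S * (3 * -Real.log r) := by
      rw [hcS]; gcongr; linarith
    calc _ ≤ K * (S * (3 * -Real.log r)) := by gcongr
      _ = _ := by rw [hSdef]; ring
  have hlx := norm_sub_le_along_cone hf hbound hx he hc ⟨hS0, hSρ.trans hρ⟩
    fun s hs => hxc s ⟨hs.1, hs.2.trans hSρ⟩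
  have hly := norm_sub_le_along_cone hf hbound hy he hc ⟨hS0, hSρ.trans hρ⟩
    fun s hs => hyc s ⟨hs.1, hs.2.trans hSρ⟩
  have hball := hxc S ⟨hS0, hSρ⟩
  rw [hcS] at hball
  have hmid : ‖f (x + S • e) - f (y + S • e)‖ ≤ K * (1 - Real.log r) * r := by
    have hsub : ∀ z ∈ closedBall (x + S • e) r, ball z r ⊆ Ω := fun z hz =>
      (ball_subset_ball' (by linarith [mem_closedBall.1 hz])).trans hball
    have := (convex_closedBall (x + S • e) r).norm_image_sub_le_of_norm_fderiv_le (𝕜 := ℝ)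
      (f := f) (C := K * (1 - Real.log r)) (x := y + S • e) (y := x + S • e)
      (fun z hz => hf z (hsub z hz (mem_ball_self hr0)))
      (fun z hz => hbound z r ⟨hr0, hr1⟩ (hsub z hz))
      (by rw [mem_closedBall, dist_add_right, dist_comm, dist_eq_norm])
      (mem_closedBall_self hr0.le)
    simpa using this
  have hmidb : K * (1 - Real.log r) * r ≤ K * (2 * (r * -Real.log r)) := by
    have : (1 - Real.log r) * r ≤ 2 * -Real.log r * r := by gcongr; linarith
    calc _ = K * ((1 - Real.log r) * r) := by ring
      _ ≤ K * (2 * -Real.log r * r) := by gcongr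
      _ = _ := by ring
  have htri : f x - f y = (f x - f (x + S • e)) + (f (x + S • e) - f (y + S • e))
      - (f y - f (y + S • e)) := by abel
  calc ‖f x - f y‖ ≤ ‖f x - f (x + S • e)‖ + ‖f (x + S • e) - f (y + S • e)‖
        + ‖f y - f (y + S • e)‖ := by
        rw [htri]; exact (norm_sub_le _ _).trans (by gcongr; exact norm_add_le _ _)
    _ ≤ K * (6 / c * (r * -Real.log r)) + K * (2 * (r * -Real.log r))
        + K * (6 / c * (r * -Real.log r)) :=
        add_le_add (add_le_add (hlx.trans hlegb) (hmid.trans hmidb)) (hly.trans hlegb)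
    _ = _ := by ring

end LogarithmicGradient

/-! ### The modulus `ω₁` and the gradient in the tube -/

theorem omegaOne_of_le {r : ℝ} (h0 : 0 < r) (h : r ≤ Real.exp (-1)) :
    omegaOne r = r * -Real.log r := by
  have : Real.log r ≤ -1 := by simpa using Real.log_le_log h0 h
  rw [omegaOne, if_neg h0.not_ge, if_pos h, abs_of_nonpos (by linarith)]

/-- On `]0, 1/e]` the factor `|ln r|` is at least `1`, and beyond it `ω₁` equals `1/e`. This serves
pairs of points at distance at least `r₀`. -/
theorem le_omegaOne {r₀ r : ℝ} (h0 : 0 < r₀) (h : r₀ ≤ r) (he : r₀ ≤ Real.exp (-1)) :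
    r₀ ≤ omegaOne r := by
  have hr := h0.trans_le h
  by_cases h1 : r ≤ Real.exp (-1)
  · have : Real.log r ≤ -1 := by simpa using Real.log_le_log hr h1
    rw [omegaOne_of_le hr h1]
    nlinarith
  · simpa [omegaOne, hr.not_ge, h1] using he

/-- Each of the `n` coordinates contributes at most `‖v‖ * ‖grad f x‖`; the crude factor `n` is
absorbed in `B`. -/
theorem norm_fderiv_le_grad {n : ℕ} {𝕜 : Type*} [RCLike 𝕜] (f : E n → 𝕜) (x : E n) :
    ‖fderiv ℝ f x‖ ≤ n * ‖grad f x‖ := by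
  refine ContinuousLinearMap.opNorm_le_bound _ (by positivity) fun v => ?_
  have hv : v = ∑ j, v j • EuclideanSpace.single j (1 : ℝ) := by
    ext i
    simp [Pi.single_apply]
  calc ‖fderiv ℝ f x v‖ = ‖∑ j, v j • fderiv ℝ f x (EuclideanSpace.single j 1)‖ := by
        conv_lhs => rw [hv]
        simp only [map_sum, map_smul]
    _ ≤ ∑ _j : Fin n, ‖v‖ * ‖grad f x‖ := by
        refine norm_sum_le_of_le _ fun j _ => ?_
        rw [norm_smul]
        gcongr
        · exact PiLp.norm_apply_le v j
        · exact PiLp.norm_apply_le (grad f x) j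
    _ = _ := by simp; ring

theorem norm_le_of_supOn_le {α F : Type*} [SeminormedAddCommGroup F] {D : Set α} {f : α → F}
    {M : ℝ≥0∞} (hM : M ≠ ⊤) (h : supOn D f ≤ M) {x : α} (hx : x ∈ D) : ‖f x‖ ≤ M.toReal := by
  have h1 : ‖f x‖ₑ ≤ M := (le_iSup₂ (f := fun x (_ : x ∈ D) => ‖f x‖ₑ) x hx).trans h
  simpa using ENNReal.toReal_mono hM h1

/-- In the inner part of the tube the gradient is bounded by the logarithm of the radius of any ball
contained in `Ω`. -/
theorem norm_grad_le_neg_log {n : ℕ} {𝕜 : Type*} [RCLike 𝕜] {Ω : Set (E n)} (hΩ : IsOpen Ω)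
    {a : E n → E n} (ha : ∀ x ∈ frontier Ω, ‖a x‖ = 1) {t₁ t₀ : ℝ} (ht₁ : IsTubeRadius Ω a t₁)
    (ht₀ : t₀ ≤ t₁) (ht₀1 : t₀ ≤ 1) {f : E n → 𝕜} {M : ℝ≥0∞} (hM : M ≠ ⊤)
    (hf : logGradSup Ω a t₁ f ≤ M) {p : E n} (hp : p ∈ tube Ω a t₀) {r : ℝ} (hr : 0 < r)
    (hball : ball p r ⊆ Ω) : ‖grad f p‖ ≤ M.toReal * -Real.log r := by
  obtain ⟨⟨x, t⟩, ⟨hx, ht⟩, rfl⟩ := hp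
  simp only at hx ht hball ⊢
  have hpΩ := hball (mem_ball_self hr)
  have hxΩ : x ∉ Ω := by
    rw [hΩ.frontier_eq] at hx; exact hx.2
  have htneg : t < 0 := by
    rcases lt_trichotomy t 0 with h | h | h
    · exact h
    · simp [h, hxΩ] at hpΩ
    · exact absurd (subset_closure hpΩ) (ht₁.outside x hx t ⟨h, ht.2.trans_le ht₀⟩)
  have hrt : r ≤ |t| := by
    by_contra! hlt
    refine hxΩ (hball ?_)
    rw [mem_ball, dist_eq_norm]
    simpa [norm_smul, ha x hx] using hlt
  -- This excludes `log |t| = 0`, where the weight is `⊤` and `toReal` would lose the bound.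
  have ht1 : |t| < 1 := by
    rw [abs_of_neg htneg]; linarith [ht.1]
  have ht0 : 0 < |t| := hr.trans_le hrt
  have hlog : Real.log |t| < 0 := Real.log_neg ht0 ht1
  have h1 : ‖Real.log |t|‖ₑ⁻¹ * ‖grad f (x + t • a x)‖ₑ ≤ M := by
    refine le_trans ?_ hf
    refine le_trans ?_ (le_iSup₂ (f := fun x (_ : x ∈ frontier Ω) => ⨆ t ∈ Ioo (-t₁) 0,
      ‖Real.log |t|‖ₑ⁻¹ * ‖grad f (x + t • a x)‖ₑ) x hx)
    exact le_iSup₂ (f := fun t (_ : t ∈ Ioo (-t₁) 0) =>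
      ‖Real.log |t|‖ₑ⁻¹ * ‖grad f (x + t • a x)‖ₑ) t ⟨by linarith [ht.1], htneg⟩
  have h2 := ENNReal.toReal_mono hM h1
  simp only [ENNReal.toReal_mul, ENNReal.toReal_inv, toReal_enorm, Real.norm_eq_abs,
    abs_of_neg hlog] at h2
  rw [inv_mul_le_iff₀ (by linarith)] at h2
  calc _ ≤ -Real.log |t| * M.toReal := h2
    _ = M.toReal * -Real.log |t| := mul_comm _ _
    _ ≤ _ := by
      have := Real.log_le_log hr hrt
      gcongr

/-- The uniformly interior points of a bounded set form a compact set. -/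
theorem isCompact_setOf_forall_notMem_le_dist {X : Type*} [PseudoMetricSpace X] [ProperSpace X]
    {Ω : Set X} (hb : Bornology.IsBounded Ω) {d : ℝ} (hd : 0 < d) :
    IsCompact {x | ∀ y ∉ Ω, d ≤ dist x y} ∧ {x | ∀ y ∉ Ω, d ≤ dist x y} ⊆ Ω := by
  have hsub : {x | ∀ y ∉ Ω, d ≤ dist x y} ⊆ Ω := by
    intro x hx
    by_contra hxΩ
    have := hx x hxΩ
    rw [dist_self] at this
    linarith
  refine ⟨isCompact_of_isClosed_isBounded ?_ (hb.subset hsub), hsub⟩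
  simp only [ofPred_forall]
  exact isClosed_iInter fun y => isClosed_iInter fun _ =>
    isClosed_le continuous_const (continuous_id.dist continuous_const)

end OmegaHolder

/-! ### The estimate -/

open OmegaHolder
theorem proposition3p6 {𝕜 : Type*} [RCLike 𝕜] (n : ℕ) (hn : 2 ≤ n)
    (Ω : Set (E n)) (hΩb : Bornology.IsBounded Ω) (hΩ : IsOpenOfClass 1 Ω)
    (U : Set (E n)) (hU : IsOpenOfClass (⊤ : ℕ∞) U) (hΩU : frontier Ω ⊆ U)
    (a : E n → E n) (ha : ContDiffClosure (⊤ : ℕ∞) a U)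
    (ϑ : ℝ) (hϑ : ϑ ∈ Ioo (0 : ℝ) 1) (τ : ℝ) (hτ : 0 < τ)
    (hfield : IsTransversalField Ω U a ϑ τ)
    (t₁ : ℝ) (ht₁ : IsTubeRadius Ω a t₁) :
    ∃ B : ℝ, 0 < B ∧ ∃ H : Set (E n), IsCompact H ∧ H ⊆ Ω ∧
      ∀ f : E n → 𝕜, ContDiffOn ℝ 1 f Ω → logGradSup Ω a t₁ f < ⊤ →
        supOn Ω f + holderConst omegaOne f Ω ≤
          ENNReal.ofReal B * max (max (supOn H f) (supOn H (grad f))) (logGradSup Ω a t₁ f) := by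
  have hnorm : ∀ x ∈ frontier Ω, ‖a x‖ = 1 := fun x hx =>
    hfield.norm_eq x (subset_closure (hΩU hx))
  obtain ⟨c, hc, ρ', hρ', hcone'⟩ := hΩ.exists_uniform_cone hΩb
  obtain ⟨ρ, hρ, hρ1, hcone⟩ : ∃ ρ > 0, ρ ≤ 1 ∧ ∀ x ∈ Ω, ∃ e : E n, ‖e‖ ≤ 1 ∧
      ∀ y ∈ Ω, dist y x < ρ → ∀ s ∈ Ioc 0 ρ, Metric.ball (y + s • e) (c * s) ⊆ Ω := by
    refine ⟨min ρ' 1, lt_min hρ' one_pos, min_le_right _ _, fun x hx => ?_⟩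
    obtain ⟨e, he, h⟩ := hcone' x hx
    exact ⟨e, he, fun y hy hyx s hs => h y hy (hyx.trans_le (min_le_left _ _)) s
      ⟨hs.1, hs.2.trans (min_le_left _ _)⟩⟩
  have hc0 := hc.1
  have hcρ : 0 < c * ρ := mul_pos hc0 hρ
  have hcρ1 : c * ρ ≤ 1 := mul_le_one₀ hc.2 hρ.le hρ1
  set t₀ : ℝ := min t₁ 1 with ht₀
  have ht₀pos : 0 < t₀ := lt_min ht₁.pos one_pos
  obtain ⟨htube, hftube⟩ := ht₁.isOpen_tube t₀ ⟨ht₀pos, min_le_left _ _⟩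
  -- `H₁` controls the gradient off the tube; `H₂` below contains the points `x + ρ • e` where
  -- climbs of height `ρ` end.
  set H₁ : Set (E n) := closure Ω \ tube Ω a t₀
  have hH₁ : IsCompact H₁ := hΩb.isCompact_closure.diff htube
  have hH₁Ω : H₁ ⊆ Ω := by
    intro x hx
    by_contra hxΩ
    exact hx.2 (hftube (hΩ.1.frontier_eq ▸ ⟨hx.1, hxΩ⟩))
  obtain ⟨hH₂, hH₂Ω⟩ := isCompact_setOf_forall_notMem_le_dist hΩb hcρ
  set H₂ : Set (E n) := {x | ∀ y ∉ Ω, c * ρ ≤ dist x y}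
  set r₀ : ℝ := min (Real.exp (-1)) (c * ρ / 2)
  have hr₀ : 0 < r₀ := lt_min (Real.exp_pos _) (by positivity)
  have hlogcρ : 0 ≤ -Real.log (c * ρ) := by
    have := Real.log_nonpos hcρ.le hcρ1; linarith
  set C₁ : ℝ := 1 + n * (ρ * (2 - Real.log (c * ρ))) with hC₁
  have hC₁pos : 0 < C₁ := by
    have : 0 ≤ ρ * (2 - Real.log (c * ρ)) := mul_nonneg hρ.le (by linarith)
    positivity
  -- The first term serves pairs closer than `r₀`; the second, pairs farther apart, through `2 sup
  -- |f|` and `ω₁ ≥ r₀`.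
  set C₂ : ℝ := n * (12 / c + 2) + 2 * C₁ / r₀
  have hC₂pos : 0 < C₂ := by positivity
  refine ⟨C₁ + C₂, by positivity, H₁ ∪ H₂, hH₁.union hH₂, union_subset hH₁Ω hH₂Ω,
    fun f hf _ => ?_⟩
  set M : ℝ≥0∞ := max (max (supOn (H₁ ∪ H₂) f) (supOn (H₁ ∪ H₂) (grad f)))
    (logGradSup Ω a t₁ f)
  rcases eq_or_ne M ⊤ with hM | hM
  · rw [hM, ENNReal.mul_top (by simp; positivity)]
    exact le_top
  have hM1 : supOn (H₁ ∪ H₂) f ≤ M := (le_max_left _ _).trans (le_max_left _ _)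
  have hM2 : supOn (H₁ ∪ H₂) (grad f) ≤ M := (le_max_right _ _).trans (le_max_left _ _)
  have hM3 : logGradSup Ω a t₁ f ≤ M := le_max_right _ _
  set K : ℝ := M.toReal
  have hK : 0 ≤ K := ENNReal.toReal_nonneg
  have hMK : M = ENNReal.ofReal K := (ENNReal.ofReal_toReal hM).symm
  have hdiff : ∀ p ∈ Ω, DifferentiableAt ℝ f p := fun p hp =>
    (hf.differentiableOn (by norm_num)).differentiableAt (hΩ.1.mem_nhds hp)
  have hnK : 0 ≤ n * K := by positivity
  have hbound : ∀ p, ∀ r ∈ Ioc (0 : ℝ) 1, Metric.ball p r ⊆ Ω →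
      ‖fderiv ℝ f p‖ ≤ n * K * (1 - Real.log r) := by
    intro p r hr hball
    have hlog : Real.log r ≤ 0 := Real.log_nonpos hr.1.le hr.2
    have hgrad : ‖grad f p‖ ≤ K * (1 - Real.log r) := by
      by_cases hp : p ∈ tube Ω a t₀
      · have := norm_grad_le_neg_log hΩ.1 hnorm ht₁ (min_le_left _ _) (min_le_right _ _) hM hM3 hp
          hr.1 hball
        linarith
      · have hpH : p ∈ H₁ := ⟨subset_closure (hball (Metric.mem_ball_self hr.1)), hp⟩
        have := norm_le_of_supOn_le hM hM2 (Or.inl hpH)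
        -- The bound by `K` on `H₁` is absorbed since `1 - log r ≥ 1`.
        nlinarith
    calc ‖fderiv ℝ f p‖ ≤ n * ‖grad f p‖ := norm_fderiv_le_grad f p
      _ ≤ n * (K * (1 - Real.log r)) := by gcongr
      _ = _ := by ring
  have hsup : ∀ x ∈ Ω, ‖f x‖ ≤ C₁ * K := by
    intro x hx
    obtain ⟨e, he, hxc⟩ := hcone x hx
    replace hxc := hxc x hx (by simpa using hρ)
    have h1 := norm_sub_le_along_cone hdiff hbound hx he hc ⟨hρ, hρ1⟩ hxc
    have h2 : x + ρ • e ∈ H₂ := by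
      intro y hy
      by_contra! hlt
      exact hy (hxc ρ ⟨hρ, le_rfl⟩ (by rwa [Metric.mem_ball, dist_comm]))
    have h3 : ‖f (x + ρ • e)‖ ≤ K := norm_le_of_supOn_le hM hM1 (Or.inr h2)
    have h4 := norm_le_norm_sub_add (f x) (f (x + ρ • e))
    calc ‖f x‖ ≤ n * K * (ρ * (2 - Real.log (c * ρ))) + K := by linarith
      _ = C₁ * K := by rw [hC₁]; ring
  have hhol : ∀ x ∈ Ω, ∀ y ∈ Ω, x ≠ y → ‖f x - f y‖ ≤ C₂ * K * omegaOne ‖x - y‖ := by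
    intro x hx y hy hxy
    have hr : 0 < ‖x - y‖ := norm_pos_iff.2 (sub_ne_zero.2 hxy)
    rcases le_total ‖x - y‖ r₀ with h | h
    · obtain ⟨e, he, hxc⟩ := hcone x hx
      have h1 : ‖x - y‖ ≤ Real.exp (-1) := h.trans (min_le_left _ _)
      have h2 : ‖x - y‖ ≤ c * ρ / 2 := h.trans (min_le_right _ _)
      have hcρρ : c * ρ ≤ ρ := mul_le_of_le_one_left hρ.le hc.2
      have h3 := norm_sub_le_mul_log hdiff hnK hbound hx hy he hc hρ1
        (hxc x hx (by simpa using hρ))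
        (hxc y hy (by rw [dist_comm, dist_eq_norm]; linarith)) hxy h1 h2
      rw [← omegaOne_of_le hr h1] at h3
      have h4 : 0 ≤ omegaOne ‖x - y‖ := hr.le.trans (le_omegaOne hr le_rfl h1)
      refine h3.trans (mul_le_mul_of_nonneg_right ?_ h4)
      have h5 : 0 ≤ 2 * C₁ / r₀ * K := by positivity
      calc _ = n * (12 / c + 2) * K := by ring
        _ ≤ n * (12 / c + 2) * K + 2 * C₁ / r₀ * K := by linarith
        _ = _ := by ring
    · have h1 := le_omegaOne hr₀ h (min_le_left _ _)
      have h2 : ‖f x - f y‖ ≤ 2 * C₁ * K := by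
        linarith [norm_sub_le (f x) (f y), hsup x hx, hsup y hy]
      have h3 : 0 ≤ n * (12 / c + 2) * K * r₀ := by positivity
      calc ‖f x - f y‖ ≤ 2 * C₁ * K := h2
        _ = 2 * C₁ / r₀ * K * r₀ := by field_simp
        _ ≤ n * (12 / c + 2) * K * r₀ + 2 * C₁ / r₀ * K * r₀ := by linarith
        _ = C₂ * K * r₀ := by ring
        _ ≤ _ := by gcongr
  rw [hMK, ← ENNReal.ofReal_mul (by positivity), add_mul,
    ENNReal.ofReal_add (by positivity) (by positivity)]
  refine add_le_add (iSup₂_le fun x hx => ?_) (iSup₂_le fun x hx => iSup₂_le fun y hy =>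
    iSup_le fun hxy => ?_)
  · rw [← ofReal_norm]
    exact ENNReal.ofReal_le_ofReal (hsup x hx)
  · refine ENNReal.div_le_of_le_mul ?_
    rw [← ENNReal.ofReal_mul (by positivity), ← ofReal_norm]
    exact ENNReal.ofReal_le_ofReal (hhol x hx y hy hxy)
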